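/- Let $a,b,n$ be integers with $n\ge 0$, $a\ge 1$ and $b\ge\max\{a,2\}$. Let $G$ be a finite simple graph of order $p$ with $$p\ge\frac{(a+b-1)(a+b-2)+an+1}{a},$$ with minimum degree $\delta(G)$ and independence number $\alpha(G)$, and let $f:V(G)\to\mathbb{Z}^{+}$ be a function with $a\le f(x)\le b$ for all $x\in V(G)$. If $$\delta(G)\ge\frac{(b-1)p+an+a+b+1}{a+b-1}\qquad\text{and}\qquad \delta(G)>\frac{(b-2)p+2\alpha(G)+an+1}{a+b-2},$$ then $G$ is a fractional $(f,n)$-critical covered graph. That is, for every set $N\subseteq V(G)$ with $|N|=n$ and every edge $e$ of $H=G-N$ there is a function $h:E(H)\to[0,1]$ with $h(e)=1$ and $\sum_{e'\in E(H),\,e'\ni x}h(e')=f(x)$ for all $x\in V(H)$. -/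

import Mathlib

namespace FractionalFactor

/-- The fractional degree `d_G^h(x) = ∑ h(e)`, the sum running over the edges `e` of `G` that are
incident with the vertex `x`.  Only the values of `h` on edges of `G` are ever used. -/
noncomputable def fracDegree {V : Type*} [Fintype V] (G : SimpleGraph V) (h : Sym2 V → ℝ)
    (x : V) : ℝ :=
  open Classical in ∑ e ∈ G.incidenceFinset x, h e

/-- `h` is the indicator function of a fractional `(g,f)`-factor of `G`: it maps the edges of `G`
into `[0,1]`, and `g(x) ≤ d_G^h(x) ≤ f(x)` for every vertex `x`.  The factor itself is the
subgraph of `G` formed by the edges `e` with `h(e) ≠ 0`, and is determined by `h`. -/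
def IsFracFactor {V : Type*} [Fintype V] (G : SimpleGraph V) (g f : V → ℕ)
    (h : Sym2 V → ℝ) : Prop :=
  (∀ e ∈ G.edgeSet, 0 ≤ h e ∧ h e ≤ 1) ∧
    ∀ x : V, (g x : ℝ) ≤ fracDegree G h x ∧ fracDegree G h x ≤ (f x : ℝ)

/-- `G` is a fractional `(g,f)`-covered graph: for every edge `e` of `G` there is a fractional
`(g,f)`-factor of `G` whose indicator function `h` satisfies `h(e) = 1`. -/
def IsFracCovered {V : Type*} [Fintype V] (G : SimpleGraph V) (g f : V → ℕ) : Prop :=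
  ∀ e ∈ G.edgeSet, ∃ h : Sym2 V → ℝ, IsFracFactor G g f h ∧ h e = 1

/-- `G` is a fractional `(g,f,n)`-critical covered graph: whenever a set `N` of exactly `n`
vertices is removed, the remaining induced graph `G - N` is a fractional `(g,f)`-covered graph
(with `g` and `f` restricted to the remaining vertices). -/
def IsFracCriticalCovered {V : Type*} [Fintype V] (G : SimpleGraph V) (g f : V → ℕ)
    (n : ℕ) : Prop :=
  open Classical in
  ∀ N : Finset V, N.card = n →
    IsFracCovered (G.induce {x : V | x ∉ N}) (fun x => g x) (fun x => f x)

/-- `G` is a fractional `(f,n)`-critical covered graph: it is a fractional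
`(f,f,n)`-critical covered graph. -/
def IsFracFCriticalCovered {V : Type*} [Fintype V] (G : SimpleGraph V) (f : V → ℕ)
    (n : ℕ) : Prop :=
  IsFracCriticalCovered G f f n

end FractionalFactor

namespace FractionalFactor

open Finset

/-! ### Fractional factors through a fixed edge, by linear duality. -/

section Duality

variable {W : Type*} [Fintype W]

/-! The degree vectors of fractional subgraphs with value 1 on `e₀` form a compact convex set, so
`f` is attained unless some weight `w` on the vertices separates it, i.e. `dualGap` is negative at
`w`. The gap is additive when `w` is peeled level by level, so only weights in `{-1, 0, 1}` matter.
With `S` and `T` the vertices of weight -1 and 1, this leaves a Tutte-type inequality with a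
correction `k` of at most `min 2 |S|`. Since `a ≤ f ≤ b`, the worst case is `a` on `S` and `b` on
`T`. Let `h` be the least degree outside `S` among vertices of `T` where it is below `b`. If `h ≥
1`, the first degree bound and the order bound suffice; if `h = 0`, `sum_two_sub_degreeOff_le`
brings in the independence number and the second degree bound applies. -/

open scoped Classical in
/-- The sum of the vertex weights `w` over the ends of `e`. -/
noncomputable def endSum (w : W → ℝ) (e : Sym2 W) : ℝ := ∑ x with x ∈ e, w x

theorem endSum_mk (w : W → ℝ) {u v : W} (huv : u ≠ v) : endSum w s(u, v) = w u + w v := by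
  classical
  have : (univ.filter fun x => x ∈ s(u, v)) = {u, v} := by
    ext x; simp
  rw [endSum, ← sum_pair huv]
  congr 1

theorem sum_mul_fracDegree (H : SimpleGraph W) [Fintype H.edgeSet] (w : W → ℝ) (h : Sym2 W → ℝ) :
    ∑ x, w x * fracDegree H h x = ∑ e ∈ H.edgeFinset, h e * endSum w e := by
  classical
  have h1 : ∀ x, fracDegree H h x = ∑ e ∈ H.edgeFinset, if x ∈ e then h e else 0 := by
    intro x
    rw [fracDegree, ← sum_filter]
    refine sum_congr ?_ fun _ _ => rfl
    ext e
    simp [SimpleGraph.incidenceSet]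
  simp_rw [h1, mul_sum, endSum, mul_sum]
  rw [sum_comm]
  refine sum_congr rfl fun e _ => ?_
  rw [sum_filter]
  refine sum_congr rfl fun x _ => ?_
  split_ifs <;> ring

/-- The gap between the largest `w`-weighted degree sum of a fractional subgraph using `e₀` with
value one, and the `w`-weighted sum of `f`. -/
noncomputable def dualGap (H : SimpleGraph W) [Fintype H.edgeSet] (f : W → ℝ) (e₀ : Sym2 W)
    (w : W → ℝ) : ℝ :=
  ∑ e ∈ H.edgeFinset, max 0 (endSum w e) - max 0 (endSum w e₀) + endSum w e₀ - ∑ x, w x * f x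

theorem exists_fracDegree_eq_of_dualGap_nonneg (H : SimpleGraph W) [Fintype H.edgeSet]
    (f : W → ℝ) {e₀ : Sym2 W} (he₀ : e₀ ∈ H.edgeSet) (hgap : ∀ w, 0 ≤ dualGap H f e₀ w) :
    ∃ h : Sym2 W → ℝ, (∀ e, 0 ≤ h e ∧ h e ≤ 1) ∧ (∀ x, fracDegree H h x = f x) ∧ h e₀ = 1 := by
  classical
  let L : (Sym2 W → ℝ) →ₗ[ℝ] (W → ℝ) :=
    { toFun := fun h x => fracDegree H h x
      map_add' := fun h k => by ext x; simp [fracDegree, sum_add_distrib]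
      map_smul' := fun c h => by ext x; simp [fracDegree, mul_sum] }
  have hLc : Continuous L := LinearMap.continuous_of_finiteDimensional L
  -- The lower bound 1 at `e₀` builds the constraint `h e₀ = 1` into the box.
  let B : Set (Sym2 W → ℝ) := Set.Icc (fun e => if e = e₀ then 1 else 0) 1
  by_cases hf : f ∈ L '' B
  · obtain ⟨h, hB, rfl⟩ := hf
    refine ⟨h, fun e => ⟨?_, hB.2 e⟩, fun x => rfl, le_antisymm (hB.2 e₀) ?_⟩
    · refine le_trans ?_ (hB.1 e)
      dsimp only
      split_ifs <;> norm_num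
    · simpa using hB.1 e₀
  exfalso
  obtain ⟨φ, u, hlt, hu⟩ := geometric_hahn_banach_closed_point
    ((convex_Icc _ _).linear_image L) (isCompact_Icc.image hLc).isClosed hf
  set w : W → ℝ := fun x => φ (Pi.single x 1) with hw
  have hφ : ∀ d : W → ℝ, φ d = ∑ x, w x * d x := by
    intro d
    have := LinearMap.pi_apply_eq_sum_univ (φ : (W → ℝ) →ₗ[ℝ] ℝ) d
    simp only [ContinuousLinearMap.coe_coe] at this
    rw [this]
    refine sum_congr rfl fun x _ => ?_
    rw [smul_eq_mul, mul_comm, hw]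
    congr 2
    ext y
    simp [Pi.single_apply, eq_comm]
  -- This `h` maximises the `w`-weighted degree sum over the box, so the separation contradicts
  -- `hgap w`.
  let h : Sym2 W → ℝ := fun e => if e = e₀ ∨ 0 < endSum w e then 1 else 0
  have hB : h ∈ B := by
    constructor <;> intro e <;> simp only [h, Pi.one_apply] <;> grind
  have h1 := (hlt _ ⟨h, hB, rfl⟩).trans hu
  rw [hφ, hφ] at h1
  have h2 : ∑ x, w x * L h x = ∑ e ∈ H.edgeFinset, h e * endSum w e :=
    sum_mul_fracDegree H w h
  have hmem : e₀ ∈ H.edgeFinset := by simpa using he₀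
  have h3 := hgap w
  rw [dualGap] at h3
  rw [h2, ← add_sum_erase _ _ hmem] at h1
  rw [← add_sum_erase _ _ hmem] at h3
  have h4 : ∑ e ∈ H.edgeFinset.erase e₀, h e * endSum w e
      = ∑ e ∈ H.edgeFinset.erase e₀, max 0 (endSum w e) := by
    refine sum_congr rfl fun e he => ?_
    have hne := ne_of_mem_erase he
    simp only [h, hne, false_or]
    split_ifs with hp
    · rw [max_eq_right hp.le, one_mul]
    · rw [max_eq_left (not_lt.mp hp), zero_mul]
  have h5 : h e₀ = 1 := by simp [h]
  rw [h4, h5] at h1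
  linarith

theorem sign_level_cases {m x : ℝ} (hx : x ≠ 0 → m ≤ |x|) :
    ((SignType.sign x : ℝ) = 1 ∧ m ≤ x) ∨ ((SignType.sign x : ℝ) = -1 ∧ x ≤ -m) ∨
      ((SignType.sign x : ℝ) = 0 ∧ x = 0) := by
  rcases lt_trichotomy x 0 with h | h | h
  · have := hx h.ne
    rw [abs_of_neg h] at this
    exact Or.inr (Or.inl ⟨by simp [sign_neg h], by linarith⟩)
  · exact Or.inr (Or.inr ⟨by simp [h], h⟩)
  · have := hx h.ne'
    rw [abs_of_pos h] at this
    exact Or.inl ⟨by simp [sign_pos h], this⟩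

/-- Moving each nonzero entry towards 0 by `m` never flips a sign, and entries of opposite sign keep
their sum; hence the positive part splits additively. -/
theorem max_zero_add_eq_level {m x y : ℝ} (hm : 0 < m) (hx : x ≠ 0 → m ≤ |x|)
    (hy : y ≠ 0 → m ≤ |y|) :
    max 0 (x + y) = m * max 0 ((SignType.sign x : ℝ) + SignType.sign y)
      + max 0 ((x - m * SignType.sign x) + (y - m * SignType.sign y)) := by
  rcases sign_level_cases hx with ⟨h, hx'⟩ | ⟨h, hx'⟩ | ⟨h, hx'⟩ <;>
  rcases sign_level_cases hy with ⟨k, hy'⟩ | ⟨k, hy'⟩ | ⟨k, hy'⟩ <;>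
  rw [h, k] <;> norm_num <;>
  grind

/-- It suffices to check nonnegativity of the gap on weights with values in `{-1, 0, 1}`. -/
theorem dualGap_nonneg_of_sign (H : SimpleGraph W) [Fintype H.edgeSet] (f : W → ℝ)
    {e₀ : Sym2 W} (he₀ : e₀ ∈ H.edgeSet)
    (hsign : ∀ s : W → SignType, 0 ≤ dualGap H f e₀ (fun x => (s x : ℝ))) (w : W → ℝ) :
    0 ≤ dualGap H f e₀ w := by
  classical
  induction hk : (univ.filter fun x => w x ≠ 0).card using Nat.strong_induction_on
    generalizing w with
  | _ k ih =>
  by_cases hne : (univ.filter fun x => w x ≠ 0).Nonempty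
  -- Peeling off the smallest nonzero absolute value kills the weight at `z` and creates no new
  -- nonzero weight, so the support shrinks.
  · obtain ⟨z, hz, hmin⟩ := exists_min_image _ (fun x => |w x|) hne
    have hz0 : w z ≠ 0 := by simpa using hz
    set m := |w z| with hm
    have hmpos : 0 < m := abs_pos.mpr hz0
    have hle : ∀ x, w x ≠ 0 → m ≤ |w x| := fun x hx => hmin x (by simpa using hx)
    set s : W → ℝ := fun x => (SignType.sign (w x) : ℝ) with hs
    set w' : W → ℝ := fun x => w x - m * s x with hw'
    have hlt : (univ.filter fun x => w' x ≠ 0).card < k := by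
      rw [← hk]
      refine card_lt_card ⟨fun x hx => ?_, fun hsub => ?_⟩
      · simp only [mem_filter, mem_univ, true_and] at hx ⊢
        contrapose! hx
        simp [hw', hs, hx]
      · have := hsub hz
        simp only [mem_filter, mem_univ, true_and, hw', hs, hm] at this
        rcases lt_or_gt_of_ne hz0 with h | h
        · simp [abs_of_neg h, sign_neg h] at this
        · simp [abs_of_pos h, sign_pos h] at this
    have h1 := ih _ hlt w' rfl
    have h2 := hsign fun x => SignType.sign (w x)
    have hmax : ∀ e ∈ H.edgeSet, max 0 (endSum w e)
        = m * max 0 (endSum s e) + max 0 (endSum w' e) := by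
      intro e he
      induction e with
      | _ u v =>
      have huv : u ≠ v := H.ne_of_adj he
      rw [endSum_mk _ huv, endSum_mk _ huv, endSum_mk _ huv]
      exact max_zero_add_eq_level hmpos (hle u) (hle v)
    have hlin : endSum w e₀ = m * endSum s e₀ + endSum w' e₀ := by
      simp only [endSum, hw', sum_sub_distrib, mul_sum]
      ring
    have hsum : ∑ x, w x * f x = m * ∑ x, s x * f x + ∑ x, w' x * f x := by
      rw [mul_sum, ← sum_add_distrib]
      refine sum_congr rfl fun x _ => ?_
      simp only [hw']
      ring
    have hsum2 : ∑ e ∈ H.edgeFinset, max 0 (endSum w e)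
        = m * ∑ e ∈ H.edgeFinset, max 0 (endSum s e)
          + ∑ e ∈ H.edgeFinset, max 0 (endSum w' e) := by
      rw [mul_sum, ← sum_add_distrib]
      exact sum_congr rfl fun e he => hmax e (by simpa using he)
    have : dualGap H f e₀ w = m * dualGap H f e₀ s + dualGap H f e₀ w' := by
      simp only [dualGap]
      rw [hsum, hsum2, hmax e₀ he₀, hlin]
      ring
    rw [this]
    have := mul_nonneg hmpos.le h2
    exact add_nonneg this h1
  · have : w = fun x => ((0 : SignType) : ℝ) := by
      ext x
      by_contra h
      exact hne ⟨x, by simpa using h⟩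
    rw [this]
    exact hsign fun _ => 0

open scoped Classical in
/-- The number of neighbours of `x` outside `S`. -/
noncomputable def degreeOff (H : SimpleGraph W) (S : Finset W) (x : W) : ℕ :=
  (H.neighborFinset x \ S).card

theorem degreeOff_le_card_edges (H : SimpleGraph W) [Fintype H.edgeSet] (S : Finset W) {x : W}
    (hx : x ∉ S) :
    (degreeOff H S x : ℝ)
      ≤ ∑ e ∈ H.edgeFinset, open Classical in if x ∈ e ∧ ∀ y ∈ e, y ∉ S then 1 else 0 := by
  classical
  rw [← sum_filter, sum_const, nsmul_eq_mul, mul_one, Nat.cast_le, degreeOff]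
  refine card_le_card_of_injOn (fun y => s(x, y)) (fun y hy => ?_)
    (fun y _ z _ h => Sym2.congr_right.mp h)
  simp only [coe_sdiff, Set.mem_sdiff, mem_coe, SimpleGraph.mem_neighborFinset] at hy
  simpa [hx] using hy

theorem sum_degreeOff_le (H : SimpleGraph W) [Fintype H.edgeSet] (s : W → SignType) :
    ∑ x with s x = 1, (degreeOff H {y | s y = -1} x : ℝ)
      ≤ ∑ e ∈ H.edgeFinset, max 0 (endSum (fun x => (s x : ℝ)) e) := by
  classical
  calc ∑ x with s x = 1, (degreeOff H {y | s y = -1} x : ℝ)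
      ≤ ∑ x with s x = 1, ∑ e ∈ H.edgeFinset,
          if x ∈ e ∧ ∀ y ∈ e, y ∉ univ.filter (fun y => s y = -1) then (1 : ℝ) else 0 := by
        refine sum_le_sum fun x hx => ?_
        have hx1 : s x = 1 := by simpa using hx
        exact degreeOff_le_card_edges H _ (by simp [hx1])
    _ = ∑ e ∈ H.edgeFinset,
          endSum (fun x => if s x = 1 ∧ ∀ y ∈ e, s y ≠ -1 then (1 : ℝ) else 0) e := by
        rw [sum_comm]
        refine sum_congr rfl fun e _ => ?_
        rw [endSum, sum_filter, sum_filter]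
        refine sum_congr rfl fun x _ => ?_
        simp only [mem_filter, mem_univ, true_and]
        split_ifs <;> simp_all
    _ ≤ _ := by
        refine sum_le_sum fun e he => ?_
        rw [SimpleGraph.mem_edgeFinset] at he
        induction e with
        | _ u v =>
        have huv : u ≠ v := H.ne_of_adj he
        rw [endSum_mk _ huv, endSum_mk _ huv]
        simp only [Sym2.mem_iff, forall_eq_or_imp, forall_eq]
        generalize s u = i
        generalize s v = j
        cases i <;> cases j <;> norm_num [SignType.zero_eq_zero, SignType.neg_eq_neg_one, SignType.pos_eq_one,
          show (0 : SignType) ≠ -1 by decide]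

/-- The witness is the number of ends of the edge with sign -1; it bounds the price of forcing value
1 on that edge. -/
theorem max_zero_endSum_sign_le (s : W → SignType) {u v : W} (huv : u ≠ v) :
    ∃ k : ℤ, k ≤ 2 ∧ k ≤ (open Classical in ({y | s y = -1} : Finset W)).card ∧
      max 0 (endSum (fun x => (s x : ℝ)) s(u, v)) - endSum (fun x => (s x : ℝ)) s(u, v) ≤ k := by
  classical
  let P : Finset W := ({u, v} : Finset W).filter (fun y => s y = -1)
  refine ⟨P.card, ?_, ?_, ?_⟩
  · exact_mod_cast (card_filter_le _ _).trans card_le_two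
  · exact_mod_cast card_le_card (filter_subset_filter _ (subset_univ _))
  · have : ((P.card : ℤ) : ℝ) = (if s u = -1 then 1 else 0) + (if s v = -1 then 1 else 0) := by
      rw [card_filter, sum_pair huv]
      push_cast
      rfl
    rw [this, endSum_mk _ huv]
    generalize s u = i
    generalize s v = j
    cases i <;> cases j <;> norm_num [SignType.zero_eq_zero, SignType.neg_eq_neg_one, SignType.pos_eq_one,
          show (0 : SignType) ≠ -1 by decide]

open scoped Classical in
/-- A sufficient condition for a graph to be fractional `f`-covered. -/
theorem isFracCovered_of_forall_disjoint (H : SimpleGraph W) (f : W → ℕ)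
    (hST : ∀ S T : Finset W, Disjoint S T → ∀ k : ℤ, k ≤ 2 → k ≤ S.card →
      k ≤ ∑ x ∈ S, (f x : ℤ) + ∑ x ∈ T, ((degreeOff H S x : ℤ) - f x)) :
    IsFracCovered H f f := by
  intro e₀ he₀
  suffices hgap : ∀ s : W → SignType, 0 ≤ dualGap H (fun x => (f x : ℝ)) e₀ fun x => (s x : ℝ) by
    obtain ⟨h, h01, hdeg, h1⟩ := exists_fracDegree_eq_of_dualGap_nonneg H _ he₀
      (dualGap_nonneg_of_sign H _ he₀ hgap)
    exact ⟨h, ⟨fun e _ => h01 e, fun x => ⟨(hdeg x).ge, (hdeg x).le⟩⟩, h1⟩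
  intro s
  induction e₀ with
  | _ u v =>
  obtain ⟨k, hk2, hkS, hk⟩ := max_zero_endSum_sign_le s (H.ne_of_adj he₀)
  have h2 := hST {y | s y = -1} {y | s y = 1} (by
    rw [disjoint_filter]
    intro x _ hx
    rw [hx]
    decide) k hk2 hkS
  have h3 := sum_degreeOff_le H s
  have h4 : ∑ x, (s x : ℝ) * f x
      = ∑ x with s x = 1, (f x : ℝ) - ∑ x with s x = -1, (f x : ℝ) := by
    rw [sum_filter, sum_filter, ← sum_sub_distrib]
    refine sum_congr rfl fun x _ => ?_
    generalize s x = i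
    cases i <;> norm_num [SignType.zero_eq_zero, SignType.neg_eq_neg_one, SignType.pos_eq_one,
          show (0 : SignType) ≠ -1 by decide]
  have h5 : (k : ℝ) ≤ ∑ x with s x = -1, (f x : ℝ) +
      ∑ x with s x = 1, ((degreeOff H {y | s y = -1} x : ℝ) - f x) := by exact_mod_cast h2
  rw [sum_sub_distrib] at h5
  rw [dualGap, h4]
  linarith

end Duality

/-! ### Degree and independence counting. -/

section Counting

variable {W : Type*} [Fintype W]

/-- The subtraction is truncated, so only vertices with at most one neighbour off `S` count. In a
largest independent set `I` of these, each vertex pays 2 minus its degree, while each vertex outside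
`I` has a neighbour in `I`, so it pays at most 1, charged to an edge leaving `I`. The total is at
most `2 * I.card`. -/
theorem sum_two_sub_degreeOff_le (H : SimpleGraph W) {S A : Finset W} (hSA : Disjoint S A) :
    ∑ x ∈ A, (2 - degreeOff H S x) ≤ 2 * H.indepNum := by
  classical
  let A₀ := A.filter fun x => degreeOff H S x ≤ 1
  have hA₀ : ∑ x ∈ A, (2 - degreeOff H S x) = ∑ x ∈ A₀, (2 - degreeOff H S x) := by
    rw [sum_filter]
    refine sum_congr rfl fun x _ => ?_
    split_ifs <;> omega
  obtain ⟨I, hI, hmax⟩ := exists_max_image (A₀.powerset.filter fun J : Finset W => H.IsIndepSet (J : Set W)) card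
    ⟨∅, by simp [SimpleGraph.IsIndepSet]⟩
  rw [mem_filter, mem_powerset] at hI
  have hnbr : ∀ x ∈ A₀ \ I, ∃ y ∈ I, H.Adj y x := by
    intro x hx
    rw [mem_sdiff] at hx
    by_contra! hno
    have hle := hmax (insert x I) (by
      rw [mem_filter, mem_powerset]
      refine ⟨insert_subset hx.1 hI.1, ?_⟩
      rw [coe_insert]
      refine hI.2.insert fun y hy _ => ⟨fun h => hno y hy h.symm, hno y hy⟩)
    rw [card_insert_of_notMem hx.2] at hle
    omega
  have hnotS : ∀ x ∈ A₀, x ∉ S := fun x hx hxS =>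
    disjoint_left.mp hSA hxS (mem_filter.mp hx).1
  have h1 : ∑ x ∈ A₀ \ I, (2 - degreeOff H S x) ≤ (A₀ \ I).card := by
    rw [card_eq_sum_ones]
    refine sum_le_sum fun x hx => ?_
    obtain ⟨y, hy, hadj⟩ := hnbr x hx
    have : 0 < degreeOff H S x := card_pos.mpr ⟨y, by simp [hadj.symm, hnotS y (hI.1 hy)]⟩
    omega
  have h2 : (A₀ \ I).card ≤ ∑ y ∈ I, degreeOff H S y := by
    refine le_trans (card_le_card fun x hx => ?_) (card_biUnion_le (t := fun y => H.neighborFinset y \ S))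
    obtain ⟨y, hy, hadj⟩ := hnbr x hx
    exact mem_biUnion.mpr ⟨y, hy, by simp [hadj, hnotS x (mem_sdiff.mp hx).1]⟩
  have h3 : ∑ x ∈ I, (2 - degreeOff H S x) + ∑ y ∈ I, degreeOff H S y = 2 * I.card := by
    rw [← sum_add_distrib, mul_comm, ← smul_eq_mul, ← sum_const]
    refine sum_congr rfl fun x hx => ?_
    have := (mem_filter.mp (hI.1 hx)).2
    omega
  have h4 : I.card ≤ H.indepNum := SimpleGraph.IsIndepSet.card_le_indepNum hI.2
  rw [hA₀, ← sum_sdiff hI.1]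
  omega

theorem degree_le_card_add_degreeOff (H : SimpleGraph W) (S : Finset W) (x : W)
    [Fintype (H.neighborSet x)] : H.degree x ≤ S.card + degreeOff H S x := by
  classical
  rw [← SimpleGraph.card_neighborFinset_eq_degree, degreeOff, add_comm]
  have := le_card_sdiff S (H.neighborFinset x)
  convert Nat.sub_le_iff_le_add.mp this

theorem le_mul_card_add_sum_degreeOff (H : SimpleGraph W) [DecidableRel H.Adj] {a b D q α : ℤ} (ha : 1 ≤ a)
    (hb : 2 ≤ b) (hW : (Fintype.card W : ℤ) = q) (hα : (H.indepNum : ℤ) ≤ α)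
    (hD : ∀ x, D ≤ H.degree x) (hq : (a + b - 1) * (a + b - 2) + 1 ≤ a * q)
    (hdeg : (b - 1) * q + a + b + 1 ≤ (a + b - 1) * D)
    (hdegα : (b - 2) * q + 2 * α + 1 < (a + b - 2) * D)
    {S T : Finset W} (hST : Disjoint S T) {k : ℤ} (hk : k ≤ 2) (hkS : k ≤ S.card) :
    k ≤ a * S.card + ∑ x ∈ T, ((degreeOff H S x : ℤ) - b) := by
  classical
  -- Only negative terms are kept, so that the minimum degree off `S` on `T'` is below `b`.
  let T' := T.filter fun x => (degreeOff H S x : ℤ) < b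
  have hsum : ∑ x ∈ T', ((degreeOff H S x : ℤ) - b) ≤ ∑ x ∈ T, ((degreeOff H S x : ℤ) - b) := by
    rw [sum_filter]
    refine sum_le_sum fun x _ => ?_
    split_ifs <;> omega
  refine le_trans ?_ (add_le_add_right hsum _)
  have hs0 : (0 : ℤ) ≤ S.card := Int.natCast_nonneg _
  rcases T'.eq_empty_or_nonempty with hT | hT
  · rw [hT, sum_empty]
    nlinarith
  have hdisj : Disjoint S T' := disjoint_of_subset_right (filter_subset _ _) hST
  have hcard : (S.card : ℤ) + T'.card ≤ q := by
    rw [← hW, ← Nat.cast_add, ← card_union_of_disjoint hdisj]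
    exact_mod_cast card_le_univ _
  obtain ⟨z, hz, hmin⟩ := exists_min_image T' (degreeOff H S) hT
  have hzb : (degreeOff H S z : ℤ) < b := (mem_filter.mp hz).2
  have hDz : D ≤ S.card + degreeOff H S z :=
    (hD z).trans (by exact_mod_cast degree_le_card_add_degreeOff H S z)
  by_contra! hlt
  -- If the minimum is 0, then `D ≤ S.card`, and `degreeOff - b ≥ (2 - b) - (2 - degreeOff)` with
  -- truncated last term turns the sum into a bound by `2 * α`, against `hdegα`.
  rcases Nat.eq_zero_or_pos (degreeOff H S z) with h0 | hpos
  · have h1 : (∑ x ∈ T', (2 - degreeOff H S x) : ℕ) ≤ 2 * α :=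
      le_trans (b := ((2 * H.indepNum : ℕ) : ℤ))
        (by exact_mod_cast sum_two_sub_degreeOff_le H hdisj) (by push_cast; linarith)
    have h2 : (T'.card : ℤ) * (2 - b) - (∑ x ∈ T', (2 - degreeOff H S x) : ℕ)
        ≤ ∑ x ∈ T', ((degreeOff H S x : ℤ) - b) := by
      rw [← nsmul_eq_mul, ← sum_const, Nat.cast_sum, ← sum_sub_distrib]
      refine sum_le_sum fun x _ => ?_
      omega
    rw [h0] at hDz
    have h3 : (b - 2) * T'.card ≤ (b - 2) * (q - S.card) :=
      mul_le_mul_of_nonneg_left (by linarith) (by linarith)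
    have h4 : (a + b - 2) * D ≤ (a + b - 2) * S.card :=
      mul_le_mul_of_nonneg_left (by push_cast at hDz; linarith) (by linarith)
    linarith
  · set h : ℤ := (degreeOff H S z : ℤ) with hh
    have hh1 : 1 ≤ h := by omega
    have h2 : (T'.card : ℤ) * (h - b) ≤ ∑ x ∈ T', ((degreeOff H S x : ℤ) - b) := by
      rw [← nsmul_eq_mul]
      exact card_nsmul_le_sum _ _ _ fun x hx => by
        have := hmin x hx
        omega
    have h3 : (b - h) * T'.card ≤ (b - h) * (q - S.card) :=
      mul_le_mul_of_nonneg_left (by linarith) (by linarith)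
    have h4 : (a + b - h) * (D - h) ≤ (a + b - h) * S.card :=
      mul_le_mul_of_nonneg_left (by linarith) (by linarith)
    -- Integrality turns `hlt` and `k ≤ 2` into an upper bound of 1.
    have h5 : (a + b - h) * (D - h) ≤ (b - h) * q + 1 := by linarith
    have h6 := mul_le_mul_of_nonneg_left h5 (show 0 ≤ a + b - 1 by linarith)
    have h7 := mul_le_mul_of_nonneg_left hdeg (show 0 ≤ a + b - h by linarith)
    -- The factor `h - 1` vanishes at `h = 1`; the order bound is needed only for `h ≥ 2`. Combined
    -- with `h6` and `h7` this yields `a + b ≤ h`, contradicting `h < b`.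
    have h8 : 0 ≤ (h - 1) * (a * q - 1 - (a + b - 1) * (a + b - h)) := by
      rcases hh1.eq_or_lt with h1 | h1
      · simp [← h1]
      · refine mul_nonneg (by linarith) ?_
        have := mul_le_mul_of_nonneg_left (show a + b - h ≤ a + b - 2 by linarith)
          (show 0 ≤ a + b - 1 by linarith)
        linarith
    nlinarith

end Counting

/-! ### Passing to `G - N`. -/

section Induce

variable {V : Type*}

theorem indepNum_induce_le [Fintype V] (G : SimpleGraph V) (s : Set V) :
    (G.induce s).indepNum ≤ G.indepNum := by
  classical
  obtain ⟨t, ht⟩ := (G.induce s).exists_isNIndepSet_indepNum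
  rw [← ht.card_eq, ← card_map (Function.Embedding.subtype _)]
  refine SimpleGraph.IsIndepSet.card_le_indepNum ?_
  rintro x hx y hy hxy hadj
  simp only [coe_map, Set.mem_image, Function.Embedding.subtype_apply] at hx hy
  obtain ⟨x, hx, rfl⟩ := hx
  obtain ⟨y, hy, rfl⟩ := hy
  exact ht.isIndepSet hx hy (fun h => hxy (by rw [h])) hadj

theorem degree_le_degree_induce_add (G : SimpleGraph V) (N : Finset V) (x : {x : V | x ∉ N})
    [Fintype (G.neighborSet x)] [Fintype ((G.induce {x : V | x ∉ N}).neighborSet x)] :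
    G.degree x ≤ (G.induce {x : V | x ∉ N}).degree x + N.card := by
  classical
  rw [← SimpleGraph.card_neighborFinset_eq_degree, ← SimpleGraph.card_neighborFinset_eq_degree,
    ← card_map (Function.Embedding.subtype _)]
  refine le_trans (card_le_card fun y hy => ?_) (card_union_le _ _)
  rw [mem_union]
  by_cases hyN : y ∈ N
  · exact Or.inr hyN
  · exact Or.inl (by simpa [hyN] using hy)

end Induce
end FractionalFactor

theorem corollary2 {V : Type*} [Fintype V] (G : SimpleGraph V) [DecidableRel G.Adj]
    (a b n p : ℕ) (ha : 1 ≤ a) (hb : max a 2 ≤ b)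
    (hcard : Fintype.card V = p)
    (hp : (p : ℝ) ≥ (((a : ℝ) + b - 1) * ((a : ℝ) + b - 2) + a * n + 1) / a)
    (f : V → ℕ) (hf : ∀ x : V, a ≤ f x ∧ f x ≤ b)
    (hdeg : (G.minDegree : ℝ) ≥
      (((b : ℝ) - 1) * p + a * n + a + b + 1) / ((a : ℝ) + b - 1))
    (hdegα : (G.minDegree : ℝ) >
      (((b : ℝ) - 2) * p + 2 * (G.indepNum : ℝ) + a * n + 1) / ((a : ℝ) + b - 2)) :
    FractionalFactor.IsFracFCriticalCovered G f n := by
  classical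
  have hb2 : 2 ≤ b := (le_max_right a 2).trans hb
  have haR : (1 : ℝ) ≤ a := by exact_mod_cast ha
  have hbR : (2 : ℝ) ≤ b := by exact_mod_cast hb2
  rw [ge_iff_le, div_le_iff₀ (by linarith)] at hp hdeg
  rw [gt_iff_lt, div_lt_iff₀ (by linarith)] at hdegα
  have hp' : ((a : ℤ) + b - 1) * (a + b - 2) + a * n + 1 ≤ p * a := by exact_mod_cast hp
  have hdeg' : ((b : ℤ) - 1) * p + a * n + a + b + 1 ≤ G.minDegree * (a + b - 1) := by
    exact_mod_cast hdeg
  have hdegα' : ((b : ℤ) - 2) * p + 2 * G.indepNum + a * n + 1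
      < G.minDegree * (a + b - 2) := by exact_mod_cast hdegα
  intro N hN
  have hW : (Fintype.card {x : V | x ∉ N} : ℤ) = p - n := by
    have h1 : Fintype.card {x : V | x ∉ N} = Fintype.card V - N.card := by
      rw [← Fintype.card_coe N]
      exact Fintype.card_subtype_compl fun x => x ∈ N
    have h2 : N.card ≤ Fintype.card V := Finset.card_le_univ N
    omega
  refine FractionalFactor.isFracCovered_of_forall_disjoint _ _ fun S T hST k hk hkS => ?_
  -- With `q = p - n` and `D = δ - n`, the terms `a * n` in the three hypotheses are exactly what
  -- the deletion of `N` costs.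
  have hmain := FractionalFactor.le_mul_card_add_sum_degreeOff (G.induce {x : V | x ∉ N})
    (a := a) (b := b) (D := G.minDegree - n) (q := p - n) (α := G.indepNum)
    (by exact_mod_cast ha) (by exact_mod_cast hb2) (by convert hW)
    (by exact_mod_cast FractionalFactor.indepNum_induce_le G _)
    (fun x => by
      have h1 := FractionalFactor.degree_le_degree_induce_add G N x
      have h2 := G.minDegree_le_degree
      have h3 : G.minDegree ≤ (G.induce {x : V | x ∉ N}).degree x + n := by
        rw [hN] at h1
        exact (h2 x).trans h1
      omega)
    (by linarith) (by linarith) (by linarith) hST hk hkS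
  refine hmain.trans (add_le_add ?_ (Finset.sum_le_sum fun x _ => ?_))
  · rw [mul_comm, ← nsmul_eq_mul]
    exact Finset.card_nsmul_le_sum _ _ _ fun x _ => by exact_mod_cast (hf x).1
  · have := (hf x).2
    omega
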